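/- **Theorem.** Let $n\ge 1$, write $[n]=\{0,\dots,n-1\}$, and let $\gamma_0<\gamma_1<\dots<\gamma_{n-1}$ be real numbers. Consider the binary-instrument case. Let $M$ be the $0/1$ matrix with rows indexed by $(i,j,d_0,d_1)\in[n]^2\times\{0,1\}^2$ and columns indexed by $(y,d,z)\in[n]\times\{0,1\}^2$, whose entry in row $(i,j,d_0,d_1)$ and column $(y,d,z)$ is $1$ if either $d=d_z=0$ and $y=i$, or $d=d_z=1$ and $y=j$, and is $0$ otherwise. Let $c_{(i,j,d_0,d_1)}=\gamma_j-\gamma_i$ and $\mathcal H=\{v\in\mathbb R^{n\times2\times2}: Mv\le c\}$. Call $v,w$ *$M$-equivalent* if $Mv=Mw$, and *$M$-distinct* otherwise. A point $v\in\mathcal H$ is a *vertex* of $\mathcal H$ if, whenever $v=\lambda v_1+(1-\lambda)v_2$ with $\lambda\in(0,1)$ and $v_1,v_2\in\mathcal H$, the vectors $v,v_1,v_2$ are $M$-equivalent. Let $S=S_1\cup S_2\cup S_3\subseteq\{0,1\}^{n\times2\times2}$, where: * $B\in S_1$ iff there is $t\in\{0,\dots,n-2\}$ with $B_{i00}=B_{i01}=1$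 for all $i\ge t$ and $B_{i00}\ne B_{i01}$ for all $i<t$; $B_{i10}\neq B_{i11}$ for all $i\in[n]$; and there exist $i,j\in[n]$ with $B_{i10}=B_{j11}=1$. * $B\in S_2$ iff $B_{(n-1)00}=B_{(n-1)01}=B_{010}=B_{011}=1$; $B_{i00}\ne B_{i01}$ for all $i<n-1$; and $B_{j10}\neq B_{j11}$ for all $j>0$. * $B\in S_3$ iff there is $s\in\{1,\dots,n-1\}$ with $B_{i10}=B_{i11}=1$ for all $i\le s$ and $B_{i10}\neq B_{i11}$ for all $i>s$; $B_{i00}\ne B_{i01}$ for all $i\in[n]$; and there exist $i,j\in[n]$ with $B_{i00}=B_{j01}=1$. (The three sets are disjoint, and $t$, $s$ are determined by $B$.) For $B\in S$ put $\alpha=-\gamma_0-\gamma_t$ if $B\in S_1$, $\alpha=-\gamma_0-\gamma_{n-1}$ if $B\in S_2$, and $\alpha=-\gamma_s-\gamma_{n-1}$ if $B\in S_3$. Define $u(B)\in\mathbb R^{n\times2\times2}$ by $$u_{i00}=\begin{cases}-\gamma_i-\alpha& B_{i00}=1\\ \gamma_0& B_{i00}=0\end{cases},\quad u_{i10}=\begin{cases}\gamma_i&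 B_{i10}=1\\ -\gamma_{n-1}-\alpha& B_{i10}=0\end{cases},\quad u_{i01}=\begin{cases}-\gamma_i& B_{i01}=1\\ \gamma_0+\alpha& B_{i01}=0\end{cases},\quad u_{i11}=\begin{cases}\gamma_i+\alpha& B_{i11}=1\\ -\gamma_{n-1}& B_{i11}=0\end{cases}.$$ Then $\mathcal V=\{u(B):B\in S\}$ is a set of pairwise $M$-distinct vertices of $\mathcal H$, and every vertex of $\mathcal H$ is $M$-equivalent to a member of $\mathcal V$. Moreover $B\mapsto[u(B)]$ is a bijection from $S$ onto the set of $M$-equivalence classes of vertices of $\mathcal H$, and the number of these classes, which is also $|S|$, is exactly $5\cdot4^{n-1}-2^{n+2}+4$. -/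

import Mathlib

namespace BinaryIV

/-- Index `(i, j, 𝐝)` of the full-data probability
`q_{ij,𝐝} = Q(Y⁽⁰⁾ = γ_i, Y⁽¹⁾ = γ_j, (D⁽⁰⁾,…,D⁽ˡ⁻¹⁾) = 𝐝)`. -/
abbrev Row (n l : ℕ) : Type := Fin n × Fin n × (Fin l → Fin 2)

/-- Index `(y, d, z)` of the observed probability `p_{yd,z} = P(Y = γ_y, D = d | Z = z)`. -/
abbrev Col (n l : ℕ) : Type := Fin n × Fin 2 × Fin l

/-- The variable `q_{ij,𝐝}` appears in the equation of `p_{yd,z}`, these equations being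
`p_{y0,z} = ∑_j ∑_{𝐝 : 𝐝_z = 0} q_{yj,𝐝}` and `p_{y1,z} = ∑_i ∑_{𝐝 : 𝐝_z = 1} q_{iy,𝐝}`. -/
def Appears {n l : ℕ} (r : Row n l) (k : Col n l) : Prop :=
  (k.2.1 = 0 ∧ r.2.2 k.2.2 = 0 ∧ r.1 = k.1) ∨ (k.2.1 = 1 ∧ r.2.2 k.2.2 = 1 ∧ r.2.1 = k.1)

instance {n l : ℕ} (r : Row n l) (k : Col n l) : Decidable (Appears r k) := by
  unfold Appears; infer_instance

/-- The binary constraint matrix `M`. -/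
def M (n l : ℕ) : Matrix (Row n l) (Col n l) ℝ :=
  Matrix.of fun r k => if Appears r k then 1 else 0

/-- The cost vector of the average treatment effect, `c_{ij,𝐝} = γ_j - γ_i`. -/
def cost {n : ℕ} (l : ℕ) (γ : Fin n → ℝ) : Row n l → ℝ := fun r => γ r.2.1 - γ r.1

/-- The dual polyhedron `H = {v : M v ≤ c}`. -/
def H {n : ℕ} (l : ℕ) (γ : Fin n → ℝ) : Set (Col n l → ℝ) :=
  {v | (M n l).mulVec v ≤ cost l γ}

/-- `M`-equivalence of vectors. Two vectors are `M`-distinct if this fails. -/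
def MEquiv {n l : ℕ} (v w : Col n l → ℝ) : Prop := (M n l).mulVec v = (M n l).mulVec w

/-- Vertices of `H`, in the sense of extremality modulo `ker M`. -/
def IsVertex {n l : ℕ} (γ : Fin n → ℝ) (v : Col n l → ℝ) : Prop :=
  v ∈ H l γ ∧ ∀ v₁ ∈ H l γ, ∀ v₂ ∈ H l γ, ∀ a : ℝ, 0 < a → a < 1 →
    v = a • v₁ + (1 - a) • v₂ → MEquiv v v₁ ∧ MEquiv v v₂

/-- `M`-equivalence restricted to the vertices of `H`. -/
def vertexSetoid {n : ℕ} (l : ℕ) (γ : Fin n → ℝ) : Setoid {v : Col n l → ℝ // IsVertex γ v} where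
  r v w := MEquiv v.1 w.1
  iseqv := ⟨fun _ => rfl, fun h => Eq.symm h, fun h h' => Eq.trans h h'⟩

/-- The `M`-equivalence classes of vertices of `H`. -/
abbrev VertexClass {n : ℕ} (l : ℕ) (γ : Fin n → ℝ) : Type := Quotient (vertexSetoid l γ)

/-- The index `n - 1`. -/
def lastIdx (n : ℕ) [NeZero n] : Fin n := ⟨n - 1, Nat.sub_lt (NeZero.pos n) Nat.one_pos⟩

/-- Binary vectors indexed by `(y, d, z)`, for a binary instrument; `true` stands for `1`. -/
abbrev Signature (n : ℕ) : Type := Col n 2 → Bool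

/-- Membership in `S₁` with the index `t ∈ {0, …, n - 2}`. -/
def IsS1At {n : ℕ} [NeZero n] (t : Fin n) (B : Signature n) : Prop :=
  t < lastIdx n ∧
  (∀ i, t ≤ i → B (i, 0, 0) = true ∧ B (i, 0, 1) = true) ∧
  (∀ i, i < t → B (i, 0, 0) ≠ B (i, 0, 1)) ∧
  (∀ i, B (i, 1, 0) ≠ B (i, 1, 1)) ∧
  (∃ i j, B (i, 1, 0) = true ∧ B (j, 1, 1) = true)

/-- Membership in `S₃`; here `s ∈ {1, …, n - 1}` is the largest index with
`B_{s10} = B_{s11} = 1`. -/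
def IsS3At {n : ℕ} [NeZero n] (s : Fin n) (B : Signature n) : Prop :=
  0 < s ∧
  (∀ i, i ≤ s → B (i, 1, 0) = true ∧ B (i, 1, 1) = true) ∧
  (∀ i, s < i → B (i, 1, 0) ≠ B (i, 1, 1)) ∧
  (∀ i, B (i, 0, 0) ≠ B (i, 0, 1)) ∧
  (∃ i j, B (i, 0, 0) = true ∧ B (j, 0, 1) = true)

def S1 (n : ℕ) [NeZero n] : Set (Signature n) := {B | ∃ t, IsS1At t B}

def S2 (n : ℕ) [NeZero n] : Set (Signature n) :=
  {B | (B (lastIdx n, 0, 0) = true ∧ B (lastIdx n, 0, 1) = true ∧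
      B (0, 1, 0) = true ∧ B (0, 1, 1) = true) ∧
    (∀ i, i < lastIdx n → B (i, 0, 0) ≠ B (i, 0, 1)) ∧
    (∀ j, 0 < j → B (j, 1, 0) ≠ B (j, 1, 1))}

def S3 (n : ℕ) [NeZero n] : Set (Signature n) := {B | ∃ s, IsS3At s B}

/-- The admissible signatures. -/
def S (n : ℕ) [NeZero n] : Set (Signature n) := S1 n ∪ S2 n ∪ S3 n

open Classical in
/-- The number `α`: it is `-γ_0 - γ_t` on `S₁`, `-γ_0 - γ_{n-1}` on `S₂` and `-γ_s - γ_{n-1}` on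
`S₃`; see the three lemmas below. -/
noncomputable def alpha {n : ℕ} [NeZero n] (γ : Fin n → ℝ) (B : Signature n) : ℝ :=
  if h : ∃ t, IsS1At t B then -γ 0 - γ h.choose
  else if h : ∃ s, IsS3At s B then -γ h.choose - γ (lastIdx n)
  else -γ 0 - γ (lastIdx n)

/-- The vertex map `B ↦ u(B)`. -/
noncomputable def u {n : ℕ} [NeZero n] (γ : Fin n → ℝ) (B : Signature n) : Col n 2 → ℝ
  | (i, 0, 0) => if B (i, 0, 0) = true then -γ i - alpha γ B else γ 0
  | (i, 1, 0) => if B (i, 1, 0) = true then γ i else -γ (lastIdx n) - alpha γ B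
  | (i, 0, 1) => if B (i, 0, 1) = true then -γ i else γ 0 + alpha γ B
  | (i, 1, 1) => if B (i, 1, 1) = true then γ i + alpha γ B else -γ (lastIdx n)

theorem IsS1At.unique {n : ℕ} [NeZero n] {t t' : Fin n} {B : Signature n}
    (h : IsS1At t B) (h' : IsS1At t' B) : t = t' := by
  obtain ⟨-, h1, h2, -⟩ := h
  obtain ⟨-, h1', h2', -⟩ := h'
  rcases lt_trichotomy t t' with hlt | heq | hlt
  · exact absurd ((h1 t le_rfl).1.trans (h1 t le_rfl).2.symm) (h2' t hlt)
  · exact heq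
  · exact absurd ((h1' t' le_rfl).1.trans (h1' t' le_rfl).2.symm) (h2 t' hlt)

theorem IsS3At.unique {n : ℕ} [NeZero n] {s s' : Fin n} {B : Signature n}
    (h : IsS3At s B) (h' : IsS3At s' B) : s = s' := by
  obtain ⟨-, h1, h2, -⟩ := h
  obtain ⟨-, h1', h2', -⟩ := h'
  rcases lt_trichotomy s s' with hlt | heq | hlt
  · exact absurd ((h1' s' le_rfl).1.trans (h1' s' le_rfl).2.symm) (h2 s' hlt)
  · exact heq
  · exact absurd ((h1 s le_rfl).1.trans (h1 s le_rfl).2.symm) (h2' s hlt)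

theorem alpha_of_isS1At {n : ℕ} [NeZero n] (γ : Fin n → ℝ) {t : Fin n} {B : Signature n}
    (h : IsS1At t B) : alpha γ B = -γ 0 - γ t := by
  have hex : ∃ t, IsS1At t B := ⟨t, h⟩
  rw [alpha, dif_pos hex, hex.choose_spec.unique h]

theorem alpha_of_mem_S2 {n : ℕ} [NeZero n] (γ : Fin n → ℝ) {B : Signature n}
    (h : B ∈ S2 n) : alpha γ B = -γ 0 - γ (lastIdx n) := by
  obtain ⟨⟨h1, h2, h3, h4⟩, -⟩ := h
  have n1 : ¬ ∃ t, IsS1At t B := fun ⟨_, _, _, _, hd, _⟩ => hd 0 (h3.trans h4.symm)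
  have n3 : ¬ ∃ s, IsS3At s B := fun ⟨_, _, _, _, hd, _⟩ => hd (lastIdx n) (h1.trans h2.symm)
  rw [alpha, dif_neg n1, dif_neg n3]

theorem alpha_of_isS3At {n : ℕ} [NeZero n] (γ : Fin n → ℝ) {s : Fin n} {B : Signature n}
    (h : IsS3At s B) : alpha γ B = -γ s - γ (lastIdx n) := by
  have hex : ∃ s, IsS3At s B := ⟨s, h⟩
  have n1 : ¬ ∃ t, IsS1At t B := fun ⟨_, _, _, _, hd, _⟩ =>
    hd s ((h.2.1 s le_rfl).1.trans (h.2.1 s le_rfl).2.symm)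
  rw [alpha, dif_neg n1, dif_pos hex, hex.choose_spec.unique h]

end BinaryIV

/-!
Shifting `v (i, d, z)` by `γ i` for `d = 0` and by `-γ i` for `d = 1` turns `M v ≤ c` into two kinds
of constraints: entries with different `d` and different `z` have sum at most `0`, and the two
entries at an index `i` of a block `d` have sum at most a capacity. A point is a vertex
iff the tight constraints determine it modulo `ker M`, and this means that the graph of tight
constraints on the coordinates is connected.

Call the maximum of the entries over `i`, for fixed `(d, z)`, their peak level. Tight constraints
between the blocks join peaks only, so connectedness forces every index of every block to have at
least one peak, every entry that is not a peak to be determined by the other entry at its index, and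
some index with two peaks whose capacity is tight. That index fixes the sums `-α` and `α` of the
peak levels in the two blocks, hence the vertex modulo `ker M`. The patterns of peaks that
occur for some `α` are exactly the elements of `S`, which determine `α`.
-/

namespace BinaryIV

section ExtremePoints

open Filter Topology

variable {ι : Type*} [Finite ι]

theorem exists_pos_forall_mul_abs_le {s x : ι → ℝ} (hs : ∀ r, 0 ≤ s r)
    (hx : ∀ r, s r = 0 → x r = 0) : ∃ ε > 0, ∀ r, ε * |x r| ≤ s r := by
  have eventually_le (r : ι) : ∀ᶠ ε in 𝓝[>] (0 : ℝ), ε * |x r| ≤ s r := by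
    rcases (hs r).eq_or_lt with h | h
    · simp [hx r h.symm, hs r]
    · have htend : Tendsto (fun ε : ℝ => ε * |x r|) (𝓝[>] 0) (𝓝 0) := by
        have hcont : Continuous fun ε : ℝ => ε * |x r| := by fun_prop
        simpa using (hcont.tendsto 0).mono_left nhdsWithin_le_nhds
      exact (htend.eventually_lt_const h).mono fun _ => le_of_lt
  obtain ⟨ε, hle, hpos⟩ := ((eventually_all.2 eventually_le).and self_mem_nhdsWithin).exists
  exact ⟨ε, hpos, hle⟩

theorem mem_extremePoints_inter_Iic_iff (W : Submodule ℝ (ι → ℝ)) {c y : ι → ℝ} :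
    y ∈ ((W : Set (ι → ℝ)) ∩ Set.Iic c).extremePoints ℝ ↔
      (y ∈ W ∧ y ≤ c) ∧ ∀ x ∈ W, (∀ r, y r = c r → x r = 0) → x = 0 := by
  rw [mem_extremePoints_iff_left]
  refine and_congr_right fun ⟨hyW, hyc⟩ => ⟨fun hext x hxW hx => ?_, fun hrigid => ?_⟩
  · obtain ⟨ε, hε, hle⟩ := exists_pos_forall_mul_abs_le (s := c - y) (x := x)
      (fun r => sub_nonneg.2 (hyc r)) (fun r hr => hx r (sub_eq_zero.1 hr).symm)
    have add_le : y + ε • x ≤ c := fun r => by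
      have := mul_le_mul_of_nonneg_left (le_abs_self (x r)) hε.le
      simpa using (add_le_add_right (this.trans (hle r)) (y r)).trans_eq (by simp)
    have sub_le : y - ε • x ≤ c := fun r => by
      have := mul_le_mul_of_nonneg_left (neg_abs_le (x r)) hε.le
      have := hle r
      simp only [Pi.sub_apply, Pi.smul_apply, smul_eq_mul] at this ⊢
      linarith
    have heq : y + ε • x = y :=
      hext _ ⟨W.add_mem hyW (W.smul_mem ε hxW), add_le⟩ _
        ⟨W.sub_mem hyW (W.smul_mem ε hxW), sub_le⟩
        ⟨1 / 2, 1 / 2, by norm_num, by norm_num, by norm_num, by module⟩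
    exact (smul_eq_zero.1 (add_eq_left.1 heq)).resolve_left hε.ne'
  · rintro y₁ ⟨hy₁W, hy₁c⟩ y₂ ⟨-, hy₂c⟩ ⟨a, b, ha, hb, hab, rfl⟩
    refine sub_eq_zero.1 (hrigid _ (W.sub_mem hy₁W hyW) fun r hr => ?_)
    have h₁ := mul_le_mul_of_nonneg_left (hy₁c r) ha.le
    have h₂ := mul_le_mul_of_nonneg_left (hy₂c r) hb.le
    obtain rfl : b = 1 - a := by linarith
    simp only [Pi.add_apply, Pi.smul_apply, Pi.sub_apply, smul_eq_mul] at hr ⊢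
    have : a * y₁ r = a * c r := by linarith
    rw [hr, mul_left_cancel₀ ha.ne' this, sub_self]

end ExtremePoints

section Polyhedron

variable {n l : ℕ} {γ : Fin n → ℝ} {v : Col n l → ℝ}

theorem isVertex_iff_mulVec_mem_extremePoints :
    IsVertex γ v ↔ (M n l).mulVec v ∈
      ((LinearMap.range (M n l).mulVecLin : Set (Row n l → ℝ)) ∩
        Set.Iic (cost l γ)).extremePoints ℝ := by
  rw [mem_extremePoints_iff_left]
  constructor
  · rintro ⟨hv, hext⟩
    refine ⟨⟨⟨v, rfl⟩, hv⟩, ?_⟩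
    rintro _ ⟨⟨v₁, rfl⟩, hv₁⟩ _ ⟨⟨v₂, rfl⟩, hv₂⟩ ⟨a, b, ha, hb, hab, hseg⟩
    obtain rfl : b = 1 - a := by linarith
    -- `v` is on the segment from `v₁` to `v₂` only modulo `ker M`, so `v₂` has to be moved.
    have hMv₂ : (M n l).mulVec ((1 - a)⁻¹ • (v - a • v₁)) = (M n l).mulVec v₂ := by
      simp only [Matrix.mulVecLin_apply] at hseg
      rw [Matrix.mulVec_smul, Matrix.mulVec_sub, ← hseg, Matrix.mulVec_smul, add_sub_cancel_left,
        inv_smul_smul₀ hb.ne']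
    refine (hext v₁ hv₁ ((1 - a)⁻¹ • (v - a • v₁)) (hMv₂.trans_le hv₂) a ha (by linarith) ?_).1.symm
    rw [smul_inv_smul₀ hb.ne', add_sub_cancel]
  · rintro ⟨⟨-, hv⟩, hext⟩
    refine ⟨hv, fun v₁ hv₁ v₂ hv₂ a ha ha' heq => ?_⟩
    have hseg : a • (M n l).mulVec v₁ + (1 - a) • (M n l).mulVec v₂ = (M n l).mulVec v := by
      rw [heq, Matrix.mulVec_add, Matrix.mulVec_smul, Matrix.mulVec_smul]
    have hb : 0 < 1 - a := sub_pos.2 ha'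
    exact ⟨(hext _ ⟨⟨v₁, rfl⟩, hv₁⟩ _ ⟨⟨v₂, rfl⟩, hv₂⟩ ⟨a, 1 - a, ha, hb, by ring, hseg⟩).symm,
      (hext _ ⟨⟨v₂, rfl⟩, hv₂⟩ _ ⟨⟨v₁, rfl⟩, hv₁⟩
        ⟨1 - a, a, hb, ha, by ring, by rw [add_comm]; exact hseg⟩).symm⟩

theorem isVertex_iff_forall_tight :
    IsVertex γ v ↔ v ∈ H l γ ∧ ∀ x : Col n l → ℝ,
      (∀ r, (M n l).mulVec v r = cost l γ r → (M n l).mulVec x r = 0) →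
        (M n l).mulVec x = 0 := by
  rw [isVertex_iff_mulVec_mem_extremePoints, mem_extremePoints_inter_Iic_iff]
  simp [H]

/-- The column of `M` at instrument value `z` in which the row `r` has a nonzero entry. -/
def Row.col (r : Row n l) (z : Fin l) : Col n l :=
  (if r.2.2 z = 0 then r.1 else r.2.1, r.2.2 z, z)

theorem appears_iff {r : Row n l} {k : Col n l} : Appears r k ↔ k = Row.col r k.2.2 := by
  obtain ⟨i, d, z⟩ := k
  obtain ⟨i₀, i₁, p⟩ := r
  simp only [Appears, Row.col, Prod.mk.injEq]
  generalize p z = e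
  fin_cases d <;> fin_cases e <;> simp [eq_comm]

theorem mulVec_apply_eq_sum (v : Col n l → ℝ) (r : Row n l) :
    (M n l).mulVec v r = ∑ z, v (Row.col r z) := by
  simp only [M, Matrix.mulVec, dotProduct, Matrix.of_apply, ite_mul, one_mul, zero_mul,
    appears_iff]
  rw [← Finset.sum_filter]
  refine Finset.sum_nbij (fun k => k.2.2) (by simp) ?_ ?_ ?_
  · intro k hk k' hk' h
    rw [(Finset.mem_filter.1 hk).2, (Finset.mem_filter.1 hk').2]
    exact congrArg _ h
  · exact fun z _ => ⟨Row.col r z, Finset.mem_filter.2 ⟨Finset.mem_univ _, rfl⟩, rfl⟩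
  · exact fun k hk => congrArg v (Finset.mem_filter.1 hk).2

end Polyhedron

section FinTwo

theorem rev_ne_self (z : Fin 2) : z.rev ≠ z := by decide +revert

theorem eq_rev_iff_ne {z z' : Fin 2} : z' = z.rev ↔ z' ≠ z := by decide +revert

theorem add_rev_eq_add_zero_one {R : Type*} [AddCommMagma R] (f : Fin 2 → R) (z : Fin 2) :
    f z + f z.rev = f 0 + f 1 := by
  fin_cases z
  exacts [rfl, add_comm _ _]

theorem forall_ne_rev_iff {β : Type*} {b : Fin 2 → β} : (∀ z, b z ≠ b z.rev) ↔ b 0 ≠ b 1 :=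
  ⟨fun h => h 0, fun h => Fin.forall_fin_two.2 ⟨h, h.symm⟩⟩

end FinTwo

section Connectivity

variable {V : Type*} {G : SimpleGraph V}

theorem exists_adj_mem_notMem (hG : G.Preconnected) {s : Set V}
    {a b : V} (ha : a ∈ s) (hb : b ∉ s) : ∃ x ∈ s, ∃ y ∉ s, G.Adj x y := by
  obtain ⟨p⟩ := hG a b
  obtain ⟨e, -, hx, hy⟩ := p.exists_boundary_dart s ha hb
  exact ⟨e.fst, hx, e.snd, hy, e.adj⟩

theorem preconnected_iff_forall_eq :
    G.Preconnected ↔ ∀ φ : V → ℝ, (∀ a b, G.Adj a b → φ a = φ b) → ∀ a b, φ a = φ b := by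
  classical
  constructor
  · intro hG φ hφ a b
    by_contra hab
    obtain ⟨x, hx, y, hy, hxy⟩ := exists_adj_mem_notMem hG (s := {k | φ k = φ a}) rfl (Ne.symm hab)
    exact hy ((hφ x y hxy).symm.trans hx)
  · intro h a b
    have reachable_iff (x y) (hxy : G.Adj x y) : G.Reachable a x ↔ G.Reachable a y :=
      ⟨fun hx => hx.trans hxy.reachable, fun hy => hy.trans hxy.symm.reachable⟩
    have hab := h (fun k => if G.Reachable a k then 1 else 0)
      (fun x y hxy => by simp only [reachable_iff x y hxy]) a b
    simpa using hab

end Connectivity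

section CoupledSystem

variable {ι : Type*} {F : ι → Fin 2 → ℝ} {w : ι × Fin 2 × Fin 2 → ℝ}

/-- The system `M v ≤ c` in the coordinates `centered`: the two entries at index `i` of block `d`
have sum at most the capacity `F i d`, and entries with different `d` and different `z` have sum at
most `0`. -/
structure IsFeasible (F : ι → Fin 2 → ℝ) (w : ι × Fin 2 × Fin 2 → ℝ) : Prop where
  add_le : ∀ i d z, w (i, d, z) + w (i, d, z.rev) ≤ F i d
  add_nonpos : ∀ i j d z, w (i, d, z) + w (j, d.rev, z.rev) ≤ 0

theorem isFeasible_iff_zero_one : IsFeasible F w ↔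
    (∀ d i, w (i, d, 0) + w (i, d, 1) ≤ F i d) ∧
      ∀ d i j, w (i, d, 0) + w (j, d.rev, 1) ≤ 0 := by
  refine ⟨fun h => ⟨fun d i => h.add_le i d 0, fun d i j => h.add_nonpos i j d 0⟩, fun h =>
    ⟨fun i d => Fin.forall_fin_two.2 ⟨h.1 d i, ?_⟩, fun i j d =>
      Fin.forall_fin_two.2 ⟨h.2 d i j, ?_⟩⟩⟩
  · simpa [add_comm] using h.1 d i
  · simpa [add_comm] using h.2 d.rev j i

/-- The graph on the coordinates whose edges are the constraints of `IsFeasible F w` that hold with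
equality. -/
def tightGraph (F : ι → Fin 2 → ℝ) (w : ι × Fin 2 × Fin 2 → ℝ) :
    SimpleGraph (ι × Fin 2 × Fin 2) where
  Adj k k' := k'.2.2 = k.2.2.rev ∧
    ((k'.1 = k.1 ∧ k'.2.1 = k.2.1 ∧ w k + w k' = F k.1 k.2.1) ∨
      (k'.2.1 = k.2.1.rev ∧ w k + w k' = 0))
  symm := ⟨by
    rintro ⟨i, d, z⟩ ⟨j, d', z'⟩ ⟨hz, ⟨hi, hd, h⟩ | ⟨hd, h⟩⟩
    · exact ⟨by simp_all, Or.inl ⟨hi.symm, hd.symm, by simp_all [add_comm]⟩⟩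
    · exact ⟨by simp_all, Or.inr ⟨by simp_all, by rw [add_comm, h]⟩⟩⟩
  loopless := ⟨fun ⟨_, _, z⟩ h => rev_ne_self z h.1.symm⟩

theorem tightGraph_adj_same {i : ι} {d z : Fin 2} :
    (tightGraph F w).Adj (i, d, z) (i, d, z.rev) ↔ w (i, d, z) + w (i, d, z.rev) = F i d := by
  simp [tightGraph, (rev_ne_self d).symm]

theorem tightGraph_adj_rev {i j : ι} {d z : Fin 2} :
    (tightGraph F w).Adj (i, d, z) (j, d.rev, z.rev) ↔
      w (i, d, z) + w (j, d.rev, z.rev) = 0 := by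
  simp [tightGraph, rev_ne_self]

theorem exists_eq_of_tightGraph_adj {i : ι} {d z : Fin 2} {k : ι × Fin 2 × Fin 2}
    (h : (tightGraph F w).Adj (i, d, z) k) : k = (i, d, z.rev) ∨ ∃ j, k = (j, d.rev, z.rev) := by
  obtain ⟨j, d', z'⟩ := k
  obtain ⟨hz, ⟨hi, hd, -⟩ | ⟨hd, -⟩⟩ := h
  · exact Or.inl (Prod.ext hi (Prod.ext hd hz))
  · exact Or.inr ⟨j, Prod.ext rfl (Prod.ext hd hz)⟩

theorem forall_tightGraph_adj_add_eq_zero_iff {x : ι × Fin 2 × Fin 2 → ℝ} :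
    (∀ k k', (tightGraph F w).Adj k k' → x k + x k' = 0) ↔
      (∀ d i, w (i, d, 0) + w (i, d, 1) = F i d → x (i, d, 0) + x (i, d, 1) = 0) ∧
        ∀ d i j, w (i, d, 0) + w (j, d.rev, 1) = 0 → x (i, d, 0) + x (j, d.rev, 1) = 0 := by
  constructor
  · exact fun h => ⟨fun d i hi => h _ _ (tightGraph_adj_same.2 hi),
      fun d i j hij => h _ _ (tightGraph_adj_rev.2 hij)⟩
  · rintro ⟨hsame, hrev⟩ ⟨i, d, z⟩ k hadj
    obtain rfl | ⟨j, rfl⟩ := exists_eq_of_tightGraph_adj hadj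
    · have htight := tightGraph_adj_same.1 hadj
      fin_cases z
      · exact hsame d i htight
      · exact (add_comm _ _).trans (hsame d i ((add_comm _ _).trans htight))
    · have htight := tightGraph_adj_rev.1 hadj
      fin_cases z
      · exact hrev d i j htight
      · have := hrev d.rev j i
        rw [Fin.rev_rev] at this
        exact (add_comm _ _).trans (this ((add_comm _ _).trans htight))

theorem add_eq_or_exists_add_eq_zero (hconn : (tightGraph F w).Preconnected) (i : ι)
    (d z : Fin 2) :
    w (i, d, z) + w (i, d, z.rev) = F i d ∨ ∃ j, w (i, d, z) + w (j, d.rev, z.rev) = 0 := by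
  have : Nonempty ι := ⟨i⟩
  obtain ⟨k, hk⟩ := hconn.exists_adj_of_nontrivial (i, d, z)
  obtain rfl | ⟨j, rfl⟩ := exists_eq_of_tightGraph_adj hk
  · exact Or.inl (tightGraph_adj_same.1 hk)
  · exact Or.inr ⟨j, tightGraph_adj_rev.1 hk⟩

theorem IsFeasible.exists_add_eq_zero (hw : IsFeasible F w)
    (hconn : (tightGraph F w).Preconnected) {d : Fin 2} (hF : ∃ i j, 0 ≤ F i d + F j d.rev)
    (z : Fin 2) : ∃ i j, w (i, d, z) + w (j, d.rev, z.rev) = 0 := by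
  obtain ⟨i, j, hij⟩ := hF
  rcases add_eq_or_exists_add_eq_zero hconn i d z with hi | hi
  · rcases add_eq_or_exists_add_eq_zero hconn j d.rev z.rev with hj | ⟨k, hk⟩
    · have h := hw.add_nonpos i j d z
      have h' := hw.add_nonpos i j d z.rev
      simp only [Fin.rev_rev] at hj h'
      exact ⟨i, j, by linarith⟩
    · simp only [Fin.rev_rev] at hk
      exact ⟨k, j, by rw [add_comm, hk]⟩
  · exact ⟨i, hi⟩

/-- `μ d z` is the maximum of `w` on the arm `(·, d, z)`, and the maxima on two arms that differ in
both labels cancel, so that some constraint between the two arms is tight. -/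
structure HasPeaks (w : ι × Fin 2 × Fin 2 → ℝ) (μ : Fin 2 → Fin 2 → ℝ) : Prop where
  le : ∀ i d z, w (i, d, z) ≤ μ d z
  exists_eq : ∀ d z, ∃ i, w (i, d, z) = μ d z
  add_rev : ∀ d z, μ d z + μ d.rev z.rev = 0

theorem IsFeasible.exists_hasPeaks (hw : IsFeasible F w) (hconn : (tightGraph F w).Preconnected)
    (hF : ∀ d : Fin 2, ∃ i j, 0 ≤ F i d + F j d.rev) : ∃ μ, HasPeaks w μ := by
  choose p q hpq using fun d => hw.exists_add_eq_zero hconn (hF d)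
  have le_peak (i d z) : w (i, d, z) ≤ w (p d z, d, z) := by
    linarith [hpq d z, hw.add_nonpos i (q d z) d z]
  refine ⟨fun d z => w (p d z, d, z), le_peak, fun d z => ⟨p d z, rfl⟩, fun d z => ?_⟩
  exact le_antisymm (hw.add_nonpos _ _ d z) (by linarith [hpq d z, le_peak (q d z) d.rev z.rev])

section HasPeaks

variable {μ : Fin 2 → Fin 2 → ℝ}

theorem HasPeaks.add_eq_zero_iff (hμ : HasPeaks w μ) {i j : ι} {d z : Fin 2} :
    w (i, d, z) + w (j, d.rev, z.rev) = 0 ↔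
      w (i, d, z) = μ d z ∧ w (j, d.rev, z.rev) = μ d.rev z.rev := by
  have hi := hμ.le i d z
  have hj := hμ.le j d.rev z.rev
  have h := hμ.add_rev d z
  constructor
  · intro h0
    constructor <;> linarith
  · rintro ⟨h₁, h₂⟩
    rw [h₁, h₂, h]

theorem HasPeaks.add_eq_of_ne (hμ : HasPeaks w μ) (hconn : (tightGraph F w).Preconnected)
    {i : ι} {d z : Fin 2} (hne : w (i, d, z) ≠ μ d z) :
    w (i, d, z) + w (i, d, z.rev) = F i d :=
  (add_eq_or_exists_add_eq_zero hconn i d z).resolve_right fun ⟨_, hj⟩ =>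
    hne (hμ.add_eq_zero_iff.1 hj).1

theorem HasPeaks.eq_or_eq_rev (hμ : HasPeaks w μ) (hconn : (tightGraph F w).Preconnected)
    (i : ι) (d z : Fin 2) : w (i, d, z) = μ d z ∨ w (i, d, z.rev) = μ d z.rev := by
  by_contra! hne
  obtain ⟨⟨i', d', z'⟩, ⟨rfl, rfl⟩, k, hk, hadj⟩ := exists_adj_mem_notMem hconn
    (s := {k | k.1 = i ∧ k.2.1 = d}) (a := (i, d, z)) (b := (i, d.rev, z)) ⟨rfl, rfl⟩
    fun h => rev_ne_self d h.2
  obtain rfl | ⟨j, rfl⟩ := exists_eq_of_tightGraph_adj hadj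
  · exact hk ⟨rfl, rfl⟩
  · have hpeak := (hμ.add_eq_zero_iff.1 (tightGraph_adj_rev.1 hadj)).1
    obtain rfl | rfl : z' = z ∨ z' = z.rev := by rw [eq_rev_iff_ne]; exact em _
    exacts [hne.1 hpeak, hne.2 hpeak]

theorem HasPeaks.exists_threshold (hμ : HasPeaks w μ) (hconn : (tightGraph F w).Preconnected) :
    ∃ i d, F i d = μ d 0 + μ d 1 := by
  obtain ⟨a, ha⟩ := hμ.exists_eq 0 0
  obtain ⟨b, hb⟩ := hμ.exists_eq 0 1
  -- An edge inside an index `i` whose ends are not both peaks flips both sides of this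
  -- equivalence, and an edge between two indices preserves both.
  obtain ⟨⟨i, d, z⟩, hk, k, hk', hadj⟩ := exists_adj_mem_notMem hconn
    (s := {k | w k = μ k.2.1 k.2.2 ↔ k.2.1 = k.2.2}) (a := (a, 0, 0)) (b := (b, 0, 1))
    (by simp [ha]) (by simp [hb])
  obtain rfl | ⟨j, rfl⟩ := exists_eq_of_tightGraph_adj hadj
  · have hpeaks := hμ.eq_or_eq_rev hconn i d z
    simp only [Set.mem_ofPred_eq, eq_rev_iff_ne] at hk hk'
    obtain ⟨h₁, h₂⟩ : w (i, d, z) = μ d z ∧ w (i, d, z.rev) = μ d z.rev := by tauto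
    exact ⟨i, d, by
      rw [← tightGraph_adj_same.1 hadj, h₁, h₂, add_rev_eq_add_zero_one]⟩
  · have hpeaks := hμ.add_eq_zero_iff.1 (tightGraph_adj_rev.1 hadj)
    simp only [Set.mem_ofPred_eq, Fin.rev_inj] at hk hk'
    tauto

end HasPeaks

/-- Signatures `B` that mark the peaks of a feasible `w` with connected tight graph, where `t d` is
the sum of the two peak levels in block `d`: the index `i` has both peaks in block `d` when its
capacity `F i d` leaves room for both, and exactly one otherwise. -/
structure IsPeakPattern (F : ι → Fin 2 → ℝ) (t : Fin 2 → ℝ) (B : ι × Fin 2 × Fin 2 → Bool) :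
    Prop where
  full : ∀ i d, t d ≤ F i d → ∀ z, B (i, d, z) = true
  split : ∀ i d, F i d < t d → ∀ z, B (i, d, z) ≠ B (i, d, z.rev)
  attained : ∀ d z, ∃ i, B (i, d, z) = true
  threshold : ∃ i d, F i d = t d

/-- The vector with peaks of height `μ d z` at the indices marked by `B`, the other entries being
fixed by tightness of the constraint inside their index. -/
def peakVector (F : ι → Fin 2 → ℝ) (μ : Fin 2 → Fin 2 → ℝ) (B : ι × Fin 2 × Fin 2 → Bool) :
    ι × Fin 2 × Fin 2 → ℝ :=
  fun (i, d, z) => if B (i, d, z) = true then μ d z else F i d - μ d z.rev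

section IsPeakPattern

variable {μ : Fin 2 → Fin 2 → ℝ} {B : ι × Fin 2 × Fin 2 → Bool}

open Classical in
theorem HasPeaks.isPeakPattern (hμ : HasPeaks w μ) (hw : IsFeasible F w)
    (hconn : (tightGraph F w).Preconnected) :
    IsPeakPattern F (fun d => μ d 0 + μ d 1) fun k => decide (w k = μ k.2.1 k.2.2) where
  full i d h z := by
    by_contra hne
    have hne : w (i, d, z) ≠ μ d z := by simpa using hne
    rw [← add_rev_eq_add_zero_one (μ d) z] at h
    linarith [hμ.add_eq_of_ne hconn hne, hμ.le i d z.rev, (hμ.le i d z).lt_of_ne hne]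
  split i d h z := by
    have hor := hμ.eq_or_eq_rev hconn i d z
    have hnand : ¬(w (i, d, z) = μ d z ∧ w (i, d, z.rev) = μ d z.rev) := fun ⟨h₁, h₂⟩ => by
      rw [← add_rev_eq_add_zero_one (μ d) z, ← h₁, ← h₂] at h
      exact h.not_ge (hw.add_le i d z)
    simp only [ne_eq, decide_eq_decide]
    tauto
  attained d z := by simpa using hμ.exists_eq d z
  threshold := hμ.exists_threshold hconn

open Classical in
theorem HasPeaks.eq_peakVector (hμ : HasPeaks w μ) (hconn : (tightGraph F w).Preconnected) :
    w = peakVector F μ fun k => decide (w k = μ k.2.1 k.2.2) := by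
  funext ⟨i, d, z⟩
  by_cases h : w (i, d, z) = μ d z
  · simp [peakVector, h]
  · have hrev := (hμ.eq_or_eq_rev hconn i d z).resolve_left h
    have htight := hμ.add_eq_of_ne hconn h
    simp only [peakVector, h, decide_false, Bool.false_eq_true, if_false]
    linarith

variable (hμ : ∀ d z, μ d z + μ d.rev z.rev = 0)
  (hB : IsPeakPattern F (fun d => μ d 0 + μ d 1) B) {i j : ι} {d z : Fin 2}

include hB in
theorem IsPeakPattern.lt_of_eq_false (h : B (i, d, z) = false) : F i d < μ d z + μ d z.rev := by
  rw [add_rev_eq_add_zero_one]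
  by_contra! hle
  simp [hB.full i d hle z] at h

include hB in
theorem IsPeakPattern.rev_eq_true (h : B (i, d, z) = false) : B (i, d, z.rev) = true := by
  have hlt := hB.lt_of_eq_false h
  rw [add_rev_eq_add_zero_one] at hlt
  simpa [h] using (hB.split i d hlt z).symm

include hB in
theorem IsPeakPattern.peakVector_eq_iff :
    peakVector F μ B (i, d, z) = μ d z ↔ B (i, d, z) = true := by
  cases h : B (i, d, z) with
  | true => simp [peakVector, h]
  | false => simpa [peakVector, h] using (sub_lt_iff_lt_add.2 (hB.lt_of_eq_false h)).ne

include hμ hB in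
theorem IsPeakPattern.hasPeaks : HasPeaks (peakVector F μ B) μ where
  le i d z := by
    cases h : B (i, d, z) with
    | true => simp [peakVector, h]
    | false => simpa [peakVector, h] using (hB.lt_of_eq_false h).le
  exists_eq d z := by simpa only [hB.peakVector_eq_iff] using hB.attained d z
  add_rev := hμ

include hB in
theorem IsPeakPattern.add_eq_of_eq_false (h : B (i, d, z) = false) :
    peakVector F μ B (i, d, z) + peakVector F μ B (i, d, z.rev) = F i d := by
  simp [peakVector, h, hB.rev_eq_true h]

include hμ hB in
theorem IsPeakPattern.isFeasible : IsFeasible F (peakVector F μ B) where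
  add_le i d z := by
    cases h : B (i, d, z) with
    | false => exact (hB.add_eq_of_eq_false h).le
    | true =>
      cases h' : B (i, d, z.rev) with
      | false => simpa [add_comm] using (hB.add_eq_of_eq_false h').le
      | true =>
        by_contra! hlt
        rw [hB.peakVector_eq_iff.2 h, hB.peakVector_eq_iff.2 h', add_rev_eq_add_zero_one] at hlt
        exact hB.split i d hlt z (h.trans h'.symm)
  add_nonpos i j d z := by
    have hpeaks := hB.hasPeaks hμ
    exact (add_le_add (hpeaks.le i d z) (hpeaks.le j d.rev z.rev)).trans_eq (hμ d z)

include hμ hB in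
theorem IsPeakPattern.adj_rev (hi : B (i, d, z) = true) (hj : B (j, d.rev, z.rev) = true) :
    (tightGraph F (peakVector F μ B)).Adj (i, d, z) (j, d.rev, z.rev) := by
  rw [tightGraph_adj_rev, hB.peakVector_eq_iff.2 hi, hB.peakVector_eq_iff.2 hj, hμ]

include hμ hB in
theorem IsPeakPattern.reachable_of_eq_true (hi : B (i, d, z) = true) (hj : B (j, d, z) = true) :
    (tightGraph F (peakVector F μ B)).Reachable (i, d, z) (j, d, z) := by
  obtain ⟨k, hk⟩ := hB.attained d.rev z.rev
  exact (hB.adj_rev hμ hi hk).reachable.trans (hB.adj_rev hμ hj hk).reachable.symm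

include hμ hB in
theorem IsPeakPattern.preconnected : (tightGraph F (peakVector F μ B)).Preconnected := by
  obtain ⟨i₀, d₀, h₀⟩ := hB.threshold
  have both (z) : B (i₀, d₀, z) = true := hB.full i₀ d₀ h₀.ge z
  have hadj : (tightGraph F (peakVector F μ B)).Adj (i₀, d₀, 0) (i₀, d₀, 1) := by
    refine tightGraph_adj_same.2 ?_
    rw [hB.peakVector_eq_iff.2 (both _), hB.peakVector_eq_iff.2 (both _), h₀]
    rfl
  have block (z) : (tightGraph F (peakVector F μ B)).Reachable (i₀, d₀, 0) (i₀, d₀, z) := by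
    fin_cases z
    exacts [.rfl, hadj.reachable]
  have peak (i d z) (h : B (i, d, z) = true) :
      (tightGraph F (peakVector F μ B)).Reachable (i₀, d₀, 0) (i, d, z) := by
    by_cases hd : d = d₀
    · subst hd
      exact (block z).trans (hB.reachable_of_eq_true hμ (both z) h)
    · obtain rfl := eq_rev_iff_ne.2 hd
      have hadj := hB.adj_rev hμ (both z.rev) (j := i) (by simpa using h)
      rw [Fin.rev_rev] at hadj
      exact (block z.rev).trans hadj.reachable
  refine (SimpleGraph.connected_iff_exists_forall_reachable _).2 ⟨(i₀, d₀, 0), ?_⟩ |>.preconnected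
  rintro ⟨i, d, z⟩
  cases h : B (i, d, z) with
  | true => exact peak i d z h
  | false =>
    have hadj := tightGraph_adj_same.2 (hB.add_eq_of_eq_false h)
    exact (peak i d z.rev (hB.rev_eq_true h)).trans hadj.symm.reachable

include hμ hB in
theorem IsPeakPattern.eq_of_forall_eq_add {μ' : Fin 2 → Fin 2 → ℝ} {B' : ι × Fin 2 × Fin 2 → Bool}
    (hμ' : ∀ d z, μ' d z + μ' d.rev z.rev = 0)
    (hB' : IsPeakPattern F (fun d => μ' d 0 + μ' d 1) B') {e : Fin 2 → ℝ}
    (h : ∀ i d z, peakVector F μ B (i, d, z) = peakVector F μ' B' (i, d, z) + e z) : B = B' := by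
  have hlevel (d z) : μ d z = μ' d z + e z := by
    obtain ⟨i, hi⟩ := (hB.hasPeaks hμ).exists_eq d z
    obtain ⟨j, hj⟩ := (hB'.hasPeaks hμ').exists_eq d z
    linarith [h i d z, h j d z, (hB.hasPeaks hμ).le j d z, (hB'.hasPeaks hμ').le i d z]
  funext ⟨i, d, z⟩
  rw [Bool.eq_iff_iff, ← hB.peakVector_eq_iff, ← hB'.peakVector_eq_iff, h, hlevel, add_left_inj]

end IsPeakPattern

theorem isFeasible_and_preconnected_iff (hF : ∀ d : Fin 2, ∃ i j, 0 ≤ F i d + F j d.rev) :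
    IsFeasible F w ∧ (tightGraph F w).Preconnected ↔
      ∃ μ B, (∀ d z, μ d z + μ d.rev z.rev = 0) ∧
        IsPeakPattern F (fun d => μ d 0 + μ d 1) B ∧ w = peakVector F μ B := by
  classical
  constructor
  · rintro ⟨hw, hconn⟩
    obtain ⟨μ, hμ⟩ := hw.exists_hasPeaks hconn hF
    exact ⟨μ, _, hμ.add_rev, hμ.isPeakPattern hw hconn, hμ.eq_peakVector hconn⟩
  · rintro ⟨μ, B, hμ, hB, rfl⟩
    exact ⟨hB.isFeasible hμ, hB.preconnected hμ⟩

end CoupledSystem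

section BinaryInstrument

variable {n : ℕ} {γ : Fin n → ℝ}

theorem neg_one_pow_rev (z : Fin 2) : (-1 : ℝ) ^ (z.rev : ℕ) = -(-1) ^ (z : ℕ) := by
  fin_cases z <;> simp

theorem neg_one_pow_mul_neg_one_pow_mul (m : ℕ) (a : ℝ) : (-1) ^ m * ((-1) ^ m * a) = a := by
  rw [← mul_assoc, ← mul_pow]
  simp

/-- The outcome values with the sign of their contribution to `-cost`: positive for the untreated
outcome (`d = 0`), negative for the treated one. -/
def signedValue (γ : Fin n → ℝ) : Fin 2 → Fin n → ℝ
  | 0 => γ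
  | 1 => -γ

theorem forall_row_iff {P : Col n 2 → Col n 2 → ℝ → Prop} :
    (∀ r, P (Row.col r 0) (Row.col r 1) (cost 2 γ r)) ↔
      (∀ d i k, P (i, d, 0) (i, d, 1) (signedValue γ d k - signedValue γ d i)) ∧
        ∀ d i j, P (i, d, 0) (j, d.rev, 1) (-signedValue γ d i - signedValue γ d.rev j) := by
  constructor
  · intro h
    refine ⟨Fin.forall_fin_two.2 ⟨fun i k => ?_, fun i k => ?_⟩,
      Fin.forall_fin_two.2 ⟨fun i j => ?_, fun i j => ?_⟩⟩
    · simpa [Row.col, cost, signedValue] using h (i, k, ![0, 0])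
    · simpa [Row.col, cost, signedValue, neg_add_eq_sub] using h (k, i, ![1, 1])
    · simpa [Row.col, cost, signedValue, neg_add_eq_sub] using h (i, j, ![0, 1])
    · simpa [Row.col, cost, signedValue] using h (j, i, ![1, 0])
  · rintro ⟨hsame, hcross⟩ ⟨i, j, p⟩
    simp only [Row.col, cost]
    generalize p 0 = d₀, p 1 = d₁
    fin_cases d₀ <;> fin_cases d₁
    · simpa [signedValue] using hsame 0 i j
    · simpa [signedValue, neg_add_eq_sub] using hcross 0 i j
    · simpa [signedValue] using hcross 1 j i
    · simpa [signedValue, neg_add_eq_sub] using hsame 1 j i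

theorem mulVec_eq_zero_iff {x : Col n 2 → ℝ} :
    (M n 2).mulVec x = 0 ↔
      ∀ k k' : Col n 2, (-1) ^ (k.2.2 : ℕ) * x k = (-1) ^ (k'.2.2 : ℕ) * x k' := by
  rw [funext_iff]
  simp only [mulVec_apply_eq_sum, Fin.sum_univ_two, Pi.zero_apply]
  rw [forall_row_iff (γ := 0) (P := fun k k' _ => x k + x k' = 0)]
  constructor
  · rintro ⟨hsame, hcross⟩
    have eq_zero (d i) (z : Fin 2) : (-1) ^ (z : ℕ) * x (i, d, z) = x (i, d, 0) := by
      fin_cases z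
      · simp
      · simpa using neg_eq_of_add_eq_zero_left (hsame d i i)
    have eq_rev (d i j) : x (i, d, 0) = x (j, d.rev, 0) := by
      rw [← eq_zero d.rev j 1]
      simpa using eq_neg_of_add_eq_zero_left (hcross d i j)
    have eq_same (d i j) : x (i, d, 0) = x (j, d, 0) :=
      (eq_rev d i i).trans (eq_rev d j i).symm
    rintro ⟨i, d, z⟩ ⟨j, d', z'⟩
    rw [eq_zero, eq_zero]
    by_cases hd : d' = d
    · rw [hd, eq_same]
    · rw [eq_rev_iff_ne.2 hd, eq_rev]
  · intro h
    refine ⟨fun d i _ => ?_, fun d i j => ?_⟩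
    · simpa [eq_neg_iff_add_eq_zero] using h (i, d, 0) (i, d, 1)
    · simpa [eq_neg_iff_add_eq_zero] using h (i, d, 0) (j, d.rev, 1)

theorem mEquiv_iff [NeZero n] {v w : Col n 2 → ℝ} :
    MEquiv v w ↔ ∃ c : ℝ, ∀ i d z, v (i, d, z) = w (i, d, z) + (-1) ^ (z : ℕ) * c := by
  rw [MEquiv, ← sub_eq_zero, ← Matrix.mulVec_sub, mulVec_eq_zero_iff]
  constructor
  · intro h
    refine ⟨(v - w) (0, 0, 0), fun i d z => ?_⟩
    have hk := h (0, 0, 0) (i, d, z)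
    simp only [Fin.val_zero, pow_zero, one_mul] at hk
    rw [hk, neg_one_pow_mul_neg_one_pow_mul, Pi.sub_apply, add_sub_cancel]
  · rintro ⟨c, hc⟩ ⟨i, d, z⟩ ⟨j, d', z'⟩
    simp only [Pi.sub_apply, hc, add_sub_cancel_left, neg_one_pow_mul_neg_one_pow_mul]

variable [NeZero n]

/-- The right-hand side, in the coordinates `centered`, of the strongest constraint on the sum of
the two entries at index `i` of block `d`. -/
def capacity (γ : Fin n → ℝ) (i : Fin n) : Fin 2 → ℝ
  | 0 => γ i + γ 0
  | 1 => -γ i - γ (lastIdx n)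

/-- Dual vectors in coordinates in which all constraints linking the two treatments have right-hand
side `0`. -/
def centered (γ : Fin n → ℝ) (v : Col n 2 → ℝ) : Col n 2 → ℝ :=
  fun k => v k + signedValue γ k.2.1 k.1

theorem le_lastIdx (i : Fin n) : i ≤ lastIdx n := Nat.le_sub_one_of_lt i.isLt

theorem isLeast_capacity (hγ : Monotone γ) (i : Fin n) (d : Fin 2) :
    IsLeast (Set.range fun k => signedValue γ d i + signedValue γ d k) (capacity γ i d) := by
  fin_cases d
  · refine ⟨⟨0, rfl⟩, ?_⟩
    rintro _ ⟨k, rfl⟩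
    simpa [capacity, signedValue] using hγ (Fin.zero_le k)
  · refine ⟨⟨lastIdx n, (sub_eq_add_neg _ _).symm⟩, ?_⟩
    rintro _ ⟨k, rfl⟩
    exact add_le_add_right (neg_le_neg (hγ (le_lastIdx k))) (-γ i)

theorem mem_H_iff_isFeasible (hγ : Monotone γ) {v : Col n 2 → ℝ} :
    v ∈ H 2 γ ↔ IsFeasible (capacity γ) (centered γ v) := by
  change (∀ r, (M n 2).mulVec v r ≤ cost 2 γ r) ↔ _
  simp only [mulVec_apply_eq_sum, Fin.sum_univ_two]
  rw [forall_row_iff (P := fun k k' c => v k + v k' ≤ c), isFeasible_iff_zero_one]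
  refine and_congr (forall₂_congr fun d i => ?_) (forall₃_congr fun d i j => ?_)
  · rw [le_isGLB_iff (isLeast_capacity hγ i d).isGLB, mem_lowerBounds, Set.forall_mem_range]
    refine forall_congr' fun k => ?_
    simp only [centered]
    constructor <;> intro h <;> linarith
  · simp only [centered]
    constructor <;> intro h <;> linarith

theorem forall_tight_row_iff (hγ : Monotone γ) {v : Col n 2 → ℝ} (hv : v ∈ H 2 γ)
    {x : Col n 2 → ℝ} :
    (∀ r, (M n 2).mulVec v r = cost 2 γ r → (M n 2).mulVec x r = 0) ↔
      ∀ k k', (tightGraph (capacity γ) (centered γ v)).Adj k k' → x k + x k' = 0 := by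
  simp only [mulVec_apply_eq_sum, Fin.sum_univ_two]
  rw [forall_row_iff (P := fun k k' c => v k + v k' = c → x k + x k' = 0),
    forall_tightGraph_adj_add_eq_zero_iff]
  refine and_congr (forall₂_congr fun d i => ?_) (forall₃_congr fun d i j => ?_)
  · have hcap := isLeast_capacity hγ i d
    have hle := ((mem_H_iff_isFeasible hγ).1 hv).add_le i d 0
    refine exists_imp.symm.trans (imp_congr_left ⟨?_, ?_⟩)
    · rintro ⟨k, hk⟩
      have := hcap.2 ⟨k, rfl⟩
      refine le_antisymm hle ?_
      simp only [centered]
      linarith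
    · intro h
      obtain ⟨k, hk⟩ := hcap.1
      refine ⟨k, ?_⟩
      simp only [centered] at h
      linarith
  · refine imp_congr_left ?_
    simp only [centered]
    constructor <;> intro h <;> linarith

theorem isVertex_iff_isFeasible_and_preconnected (hγ : Monotone γ) {v : Col n 2 → ℝ} :
    IsVertex γ v ↔ IsFeasible (capacity γ) (centered γ v) ∧
      (tightGraph (capacity γ) (centered γ v)).Preconnected := by
  rw [isVertex_iff_forall_tight, ← mem_H_iff_isFeasible hγ, preconnected_iff_forall_eq]
  refine and_congr_right fun hv => ?_
  simp only [forall_tight_row_iff hγ hv, mulVec_eq_zero_iff]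
  have add_eq_zero_iff {k k'} (h : (tightGraph (capacity γ) (centered γ v)).Adj k k')
      (x : Col n 2 → ℝ) :
      x k + x k' = 0 ↔ (-1) ^ (k.2.2 : ℕ) * x k = (-1) ^ (k'.2.2 : ℕ) * x k' := by
    rw [h.1, neg_one_pow_rev, neg_mul, ← mul_neg, mul_right_inj' (by positivity),
      eq_neg_iff_add_eq_zero]
  constructor
  · intro h φ hφ k k'
    have hsigned := h (fun k => (-1) ^ (k.2.2 : ℕ) * φ k) fun a b hab =>
      (add_eq_zero_iff hab fun k => (-1) ^ (k.2.2 : ℕ) * φ k).2 <| by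
        simpa only [neg_one_pow_mul_neg_one_pow_mul] using hφ a b hab
    simpa only [neg_one_pow_mul_neg_one_pow_mul] using hsigned k k'
  · exact fun h x hx => h _ fun a b hab => (add_eq_zero_iff hab x).1 (hx a b hab)

theorem mEquiv_iff_centered (γ : Fin n → ℝ) {v w : Col n 2 → ℝ} :
    MEquiv v w ↔ ∃ c : ℝ, ∀ i d z,
      centered γ v (i, d, z) = centered γ w (i, d, z) + (-1) ^ (z : ℕ) * c := by
  simp only [mEquiv_iff, centered, add_right_comm _ (signedValue γ _ _), add_left_inj]

end BinaryInstrument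

section Classification

variable {n : ℕ} [NeZero n] {γ : Fin n → ℝ} {B : Signature n} {a : ℝ}

theorem isPeakPattern_capacity_iff :
    IsPeakPattern (capacity γ) ![-a, a] B ↔
      ((∀ i, -a ≤ γ i + γ 0 → B (i, 0, 0) = true ∧ B (i, 0, 1) = true) ∧
        ∀ i, γ i + γ 0 < -a → B (i, 0, 0) ≠ B (i, 0, 1)) ∧
      ((∀ i, a ≤ -γ i - γ (lastIdx n) → B (i, 1, 0) = true ∧ B (i, 1, 1) = true) ∧
        ∀ i, -γ i - γ (lastIdx n) < a → B (i, 1, 0) ≠ B (i, 1, 1)) ∧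
      ((∃ i j, B (i, 0, 0) = true ∧ B (j, 0, 1) = true) ∧
        ∃ i j, B (i, 1, 0) = true ∧ B (j, 1, 1) = true) ∧
      ∃ i, γ i + γ 0 = -a ∨ -γ i - γ (lastIdx n) = a := by
  constructor
  · rintro ⟨hfull, hsplit, hatt, i, d, ht⟩
    have both (d) : ∃ i j, B (i, d, 0) = true ∧ B (j, d, 1) = true :=
      ⟨_, _, (hatt d 0).choose_spec, (hatt d 1).choose_spec⟩
    refine ⟨⟨fun i h => ⟨hfull i 0 h 0, hfull i 0 h 1⟩, fun i h => hsplit i 0 h 0⟩,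
      ⟨fun i h => ⟨hfull i 1 h 0, hfull i 1 h 1⟩, fun i h => hsplit i 1 h 0⟩,
      ⟨both 0, both 1⟩, i, ?_⟩
    fin_cases d
    exacts [Or.inl ht, Or.inr ht]
  · rintro ⟨⟨hfull₀, hsplit₀⟩, ⟨hfull₁, hsplit₁⟩, ⟨⟨i₀, j₀, hi₀, hj₀⟩, i₁, j₁, hi₁, hj₁⟩, k, hk⟩
    refine ⟨fun i => Fin.forall_fin_two.2 ⟨fun h => Fin.forall_fin_two.2 (hfull₀ i h),
        fun h => Fin.forall_fin_two.2 (hfull₁ i h)⟩,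
      fun i => Fin.forall_fin_two.2 ⟨fun h => ?_, fun h => ?_⟩,
      Fin.forall_fin_two.2 ⟨Fin.forall_fin_two.2 ⟨⟨i₀, hi₀⟩, j₀, hj₀⟩,
        Fin.forall_fin_two.2 ⟨⟨i₁, hi₁⟩, j₁, hj₁⟩⟩,
      k, Fin.exists_fin_two.2 hk⟩
    · exact (forall_ne_rev_iff (b := fun z => B (i, 0, z))).2 (hsplit₀ i h)
    · exact (forall_ne_rev_iff (b := fun z => B (i, 1, z))).2 (hsplit₁ i h)

theorem isPeakPattern_iff_isS1At (hγ : StrictMono γ) {t : Fin n} (ht : t < lastIdx n)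
    (ha : a = -γ 0 - γ t) : IsPeakPattern (capacity γ) ![-a, a] B ↔ IsS1At t B := by
  subst ha
  have le_iff (i) : -(-γ 0 - γ t) ≤ γ i + γ 0 ↔ t ≤ i := by
    rw [← hγ.le_iff_le]; constructor <;> intro h <;> linarith
  have lt (i) : -γ i - γ (lastIdx n) < -γ 0 - γ t := by
    linarith [hγ.monotone (Fin.zero_le i), hγ ht]
  simp only [isPeakPattern_capacity_iff, IsS1At, ← not_le, le_iff, fun i => (lt i).not_ge]
  constructor
  · rintro ⟨⟨hfull, hsplit⟩, ⟨-, hne⟩, ⟨-, hatt⟩, -⟩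
    exact ⟨not_le.2 ht, hfull, hsplit, fun i => hne i not_false, hatt⟩
  · rintro ⟨-, hfull, hsplit, hne, hatt⟩
    obtain ⟨h₀, h₁⟩ := hfull t le_rfl
    exact ⟨⟨hfull, hsplit⟩, ⟨fun _ => False.elim, fun i _ => hne i⟩, ⟨⟨t, t, h₀, h₁⟩, hatt⟩,
      t, Or.inl (by ring)⟩

theorem isPeakPattern_iff_isS3At (hγ : StrictMono γ) {s : Fin n} (hs : 0 < s)
    (ha : a = -γ s - γ (lastIdx n)) :
    IsPeakPattern (capacity γ) ![-a, a] B ↔ IsS3At s B := by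
  subst ha
  have le_iff (i) : -γ s - γ (lastIdx n) ≤ -γ i - γ (lastIdx n) ↔ i ≤ s := by
    rw [← hγ.le_iff_le]; constructor <;> intro h <;> linarith
  have lt (i) : γ i + γ 0 < -(-γ s - γ (lastIdx n)) := by
    linarith [hγ.monotone (le_lastIdx i), hγ hs]
  simp only [isPeakPattern_capacity_iff, IsS3At, ← not_le, le_iff, fun i => (lt i).not_ge]
  constructor
  · rintro ⟨⟨-, hne⟩, ⟨hfull, hsplit⟩, ⟨hatt, -⟩, -⟩
    exact ⟨not_le.2 hs, hfull, hsplit, fun i => hne i not_false, hatt⟩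
  · rintro ⟨-, hfull, hsplit, hne, hatt⟩
    obtain ⟨h₀, h₁⟩ := hfull s le_rfl
    exact ⟨⟨fun _ => False.elim, fun i _ => hne i⟩, ⟨hfull, hsplit⟩, ⟨hatt, s, s, h₀, h₁⟩,
      s, Or.inr rfl⟩

theorem isPeakPattern_iff_mem_S2 (hγ : StrictMono γ) (ha : a = -γ 0 - γ (lastIdx n)) :
    IsPeakPattern (capacity γ) ![-a, a] B ↔ B ∈ S2 n := by
  subst ha
  have le_iff (i) : -(-γ 0 - γ (lastIdx n)) ≤ γ i + γ 0 ↔ lastIdx n ≤ i := by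
    rw [← hγ.le_iff_le]; constructor <;> intro h <;> linarith
  have le_iff' (i) : -γ 0 - γ (lastIdx n) ≤ -γ i - γ (lastIdx n) ↔ i ≤ 0 := by
    rw [← hγ.le_iff_le]; constructor <;> intro h <;> linarith
  have eq_last (i) (h : lastIdx n ≤ i) : i = lastIdx n := (le_lastIdx i).antisymm h
  simp only [isPeakPattern_capacity_iff, S2, ← not_le, le_iff, le_iff', Set.mem_ofPred_eq]
  constructor
  · rintro ⟨⟨hfull₀, hsplit₀⟩, ⟨hfull₁, hsplit₁⟩, -⟩
    exact ⟨⟨(hfull₀ _ le_rfl).1, (hfull₀ _ le_rfl).2, hfull₁ 0 le_rfl⟩, hsplit₀, hsplit₁⟩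
  · rintro ⟨⟨h₀₀, h₀₁, h₁⟩, hsplit₀, hsplit₁⟩
    refine ⟨⟨fun i hi => ?_, hsplit₀⟩, ⟨fun i hi => ?_, hsplit₁⟩,
      ⟨⟨_, _, h₀₀, h₀₁⟩, _, _, h₁⟩, 0, Or.inr rfl⟩
    · rw [eq_last i hi]
      exact ⟨h₀₀, h₀₁⟩
    · rw [le_antisymm hi (Fin.zero_le i)]
      exact h₁

theorem isPeakPattern_iff_mem_S (hγ : StrictMono γ) :
    IsPeakPattern (capacity γ) ![-a, a] B ↔ B ∈ S n ∧ alpha γ B = a := by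
  constructor
  · intro hB
    have mem_S2 (ha : a = -γ 0 - γ (lastIdx n)) : B ∈ S n ∧ alpha γ B = a := by
      have h2 := (isPeakPattern_iff_mem_S2 hγ ha).1 hB
      exact ⟨Or.inl (Or.inr h2), (alpha_of_mem_S2 γ h2).trans ha.symm⟩
    obtain ⟨i, d, ht⟩ := hB.threshold
    fin_cases d
    · replace ht : a = -γ 0 - γ i := by linarith [show γ i + γ 0 = -a from ht]
      rcases (le_lastIdx i).eq_or_lt with rfl | hi
      · exact mem_S2 ht
      · have h1 := (isPeakPattern_iff_isS1At hγ hi ht).1 hB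
        exact ⟨Or.inl (Or.inl ⟨i, h1⟩), (alpha_of_isS1At γ h1).trans ht.symm⟩
    · replace ht : a = -γ i - γ (lastIdx n) := ht.symm
      rcases (Fin.zero_le i).eq_or_lt with rfl | hi
      · exact mem_S2 ht
      · have h3 := (isPeakPattern_iff_isS3At hγ hi ht).1 hB
        exact ⟨Or.inr ⟨i, h3⟩, (alpha_of_isS3At γ h3).trans ht.symm⟩
  · rintro ⟨(⟨t, h1⟩ | h2) | ⟨s, h3⟩, rfl⟩
    · exact (isPeakPattern_iff_isS1At hγ h1.1 (alpha_of_isS1At γ h1)).2 h1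
    · exact (isPeakPattern_iff_mem_S2 hγ (alpha_of_mem_S2 γ h2)).2 h2
    · exact (isPeakPattern_iff_isS3At hγ h3.1 (alpha_of_isS3At γ h3)).2 h3

end Classification

section Vertices

variable {n : ℕ} [NeZero n] {γ : Fin n → ℝ} {B : Signature n} {a : ℝ}

/-- Peak levels with block sums `-a` and `a`, normalized by the value `0` on two of the arms. -/
def peakLevel (a : ℝ) : Fin 2 → Fin 2 → ℝ := ![![-a, 0], ![0, a]]

theorem peakLevel_add_rev (a : ℝ) (d z : Fin 2) :
    peakLevel a d z + peakLevel a d.rev z.rev = 0 := by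
  fin_cases d <;> fin_cases z <;> simp [peakLevel]

theorem peakLevel_block_sum (a : ℝ) : (fun d => peakLevel a d 0 + peakLevel a d 1) = ![-a, a] := by
  funext d
  fin_cases d <;> simp [peakLevel]

theorem eq_peakLevel_add {μ : Fin 2 → Fin 2 → ℝ} (hμ : ∀ d z, μ d z + μ d.rev z.rev = 0)
    (d z : Fin 2) :
    μ d z = peakLevel (μ 1 0 + μ 1 1) d z + (-1) ^ (z : ℕ) * μ 1 0 := by
  have h₀ : μ 0 0 + μ 1 1 = 0 := hμ 0 0
  have h₁ : μ 0 1 + μ 1 0 = 0 := hμ 0 1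
  fin_cases d <;> fin_cases z <;> simp [peakLevel] <;> linarith

theorem peakVector_eq_add {ι : Type*} {F : ι → Fin 2 → ℝ} {μ μ' : Fin 2 → Fin 2 → ℝ} {c : ℝ}
    (h : ∀ d z : Fin 2, μ d z = μ' d z + (-1) ^ (z : ℕ) * c) (B : ι × Fin 2 × Fin 2 → Bool)
    (i : ι) (d z : Fin 2) :
    peakVector F μ B (i, d, z) = peakVector F μ' B (i, d, z) + (-1) ^ (z : ℕ) * c := by
  simp only [peakVector, h, neg_one_pow_rev]
  split_ifs <;> ring

theorem centered_u (γ : Fin n → ℝ) (B : Signature n) :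
    centered γ (u γ B) = peakVector (capacity γ) (peakLevel (alpha γ B)) B := by
  funext ⟨i, d, z⟩
  match d, z with
  | 0, 0 | 0, 1 | 1, 0 | 1, 1 =>
    simp only [centered, u, peakVector, peakLevel, capacity, signedValue]
    split_ifs <;> simp <;> ring

theorem isPeakPattern_of_mem_S (hγ : StrictMono γ) (hB : B ∈ S n) :
    IsPeakPattern (capacity γ)
      (fun d => peakLevel (alpha γ B) d 0 + peakLevel (alpha γ B) d 1) B := by
  rw [peakLevel_block_sum, isPeakPattern_iff_mem_S hγ]
  exact ⟨hB, rfl⟩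

theorem isVertex_u (hγ : StrictMono γ) (hB : B ∈ S n) : IsVertex γ (u γ B) := by
  have hpat := isPeakPattern_of_mem_S hγ hB
  rw [isVertex_iff_isFeasible_and_preconnected hγ.monotone, centered_u]
  exact ⟨hpat.isFeasible (peakLevel_add_rev _), hpat.preconnected (peakLevel_add_rev _)⟩

theorem eq_of_mEquiv_u (hγ : StrictMono γ) {B' : Signature n} (hB : B ∈ S n) (hB' : B' ∈ S n)
    (h : MEquiv (u γ B) (u γ B')) : B = B' := by
  obtain ⟨c, hc⟩ := (mEquiv_iff_centered γ).1 h
  simp only [centered_u] at hc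
  exact (isPeakPattern_of_mem_S hγ hB).eq_of_forall_eq_add (peakLevel_add_rev _)
    (peakLevel_add_rev _) (isPeakPattern_of_mem_S hγ hB') hc

theorem exists_capacity_add_nonneg (γ : Fin n → ℝ) (d : Fin 2) :
    ∃ i j, 0 ≤ capacity γ i d + capacity γ j d.rev := by
  have hsum : capacity γ (lastIdx n) 0 + capacity γ 0 1 = 0 := by
    simp only [capacity]
    ring
  fin_cases d
  · exact ⟨lastIdx n, 0, hsum.ge⟩
  · exact ⟨0, lastIdx n, ((add_comm _ _).trans hsum).ge⟩

theorem exists_mem_S_mEquiv_u (hγ : StrictMono γ) {v : Col n 2 → ℝ} (hv : IsVertex γ v) :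
    ∃ B ∈ S n, MEquiv v (u γ B) := by
  rw [isVertex_iff_isFeasible_and_preconnected hγ.monotone,
    isFeasible_and_preconnected_iff (exists_capacity_add_nonneg γ)] at hv
  obtain ⟨μ, B, hμ, hB, hv⟩ := hv
  have hsum : (fun d => μ d 0 + μ d 1) = ![-(μ 1 0 + μ 1 1), μ 1 0 + μ 1 1] := by
    funext d
    rw [eq_peakLevel_add hμ d 0, eq_peakLevel_add hμ d 1]
    fin_cases d <;> simp [peakLevel]
  rw [hsum, isPeakPattern_iff_mem_S hγ] at hB
  refine ⟨B, hB.1, (mEquiv_iff_centered γ).2 ⟨μ 1 0, ?_⟩⟩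
  rw [hv, centered_u, hB.2]
  exact peakVector_eq_add (eq_peakLevel_add hμ) B

end Vertices

section Counting

open Finset

variable {n : ℕ}

/-- A signature as the pair of its blocks `d = 0` and `d = 1`, each of which assigns to the index
`y` the two entries for `z = 0` and `z = 1`. -/
def blocks : Signature n ≃ (Fin n → Bool × Bool) × (Fin n → Bool × Bool) where
  toFun B := (fun y => (B (y, 0, 0), B (y, 0, 1)), fun y => (B (y, 1, 0), B (y, 1, 1)))
  invFun c k := if k.2.1 = 0 then (if k.2.2 = 0 then (c.1 k.1).1 else (c.1 k.1).2)
    else (if k.2.2 = 0 then (c.2 k.1).1 else (c.2 k.1).2)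
  left_inv B := by
    ext ⟨i, d, z⟩
    fin_cases d <;> fin_cases z <;> rfl
  right_inv _ := rfl

/-- The blocks with both entries `1` at the indices in `s` and exactly one entry `1` at the
others. -/
def blocksFullOn {ι : Type*} [Fintype ι] [DecidableEq ι] (s : Finset ι) :
    Finset (ι → Bool × Bool) :=
  Fintype.piFinset fun i => if i ∈ s then {(true, true)} else {(true, false), (false, true)}

section BlocksFullOn

variable {ι : Type*} [Fintype ι] [DecidableEq ι] {s t : Finset ι} {c : ι → Bool × Bool}

theorem mem_blocksFullOn :
    c ∈ blocksFullOn s ↔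
      (∀ i ∈ s, (c i).1 = true ∧ (c i).2 = true) ∧ ∀ i ∉ s, (c i).1 ≠ (c i).2 := by
  rw [blocksFullOn, Fintype.mem_piFinset, ← forall_and]
  refine forall_congr' fun i => ?_
  generalize c i = b
  by_cases h : i ∈ s
  · simpa [h] using Prod.ext_iff
  · simpa [h] using (by decide : ∀ b : Bool × Bool,
      b = (true, false) ∨ b = (false, true) ↔ b.1 ≠ b.2) b

theorem card_blocksFullOn : #(blocksFullOn s) = 2 ^ #sᶜ := by
  have card_pair_two : #{(true, false), (false, true)} = 2 := rfl
  simp only [blocksFullOn, Fintype.card_piFinset, apply_ite card, card_singleton, card_pair_two,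
    prod_ite, prod_const_one, one_mul, prod_const, filter_notMem_eq_sdiff, compl_eq_univ_sdiff]

theorem disjoint_blocksFullOn {i : ι} (hs : i ∈ s) (ht : i ∉ t) :
    Disjoint (blocksFullOn s) (blocksFullOn t) := by
  refine disjoint_left.2 fun c hc hc' => ?_
  obtain ⟨h₀, h₁⟩ := (mem_blocksFullOn.1 hc).1 i hs
  exact (mem_blocksFullOn.1 hc').2 i ht (h₀.trans h₁.symm)

variable (ι) in
/-- The blocks with exactly one entry `1` at each index, and with a `1` in both positions
`z = 0` and `z = 1`. -/
def mixedBlocks : Finset (ι → Bool × Bool) :=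
  blocksFullOn (∅ : Finset ι) \ {fun _ => (true, false), fun _ => (false, true)}

theorem mem_mixedBlocks :
    c ∈ mixedBlocks ι ↔
      (∀ i, (c i).1 ≠ (c i).2) ∧ ∃ i j, (c i).1 = true ∧ (c j).2 = true := by
  simp only [mixedBlocks, mem_sdiff, mem_blocksFullOn, notMem_empty, false_imp_iff, implies_true,
    not_false_eq_true, true_imp_iff, true_and, mem_insert, mem_singleton, not_or]
  refine and_congr_right fun hc => ?_
  have ne_left_iff : c ≠ (fun _ => (true, false)) ↔ ∃ j, (c j).2 = true :=
    Function.ne_iff.trans <| exists_congr fun j =>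
      (by decide : ∀ b : Bool × Bool, b.1 ≠ b.2 → (b ≠ (true, false) ↔ b.2 = true)) _ (hc j)
  have ne_right_iff : c ≠ (fun _ => (false, true)) ↔ ∃ i, (c i).1 = true :=
    Function.ne_iff.trans <| exists_congr fun i =>
      (by decide : ∀ b : Bool × Bool, b.1 ≠ b.2 → (b ≠ (false, true) ↔ b.1 = true)) _ (hc i)
  rw [← ne_eq, ← ne_eq, ne_left_iff, ne_right_iff, and_comm, exists_and_exists_comm]

theorem card_mixedBlocks [Nonempty ι] : #(mixedBlocks ι) = 2 ^ Fintype.card ι - 2 := by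
  have hsub : {fun _ => (true, false), fun _ => (false, true)} ⊆
      blocksFullOn (∅ : Finset ι) := by
    simp [insert_subset_iff, mem_blocksFullOn]
  have hne : (fun _ : ι => (true, false)) ≠ fun _ => (false, true) := by
    simp [funext_iff]
  rw [mixedBlocks, card_sdiff_of_subset hsub, card_pair hne, card_blocksFullOn]
  simp

theorem disjoint_blocksFullOn_mixedBlocks {i : ι} (hs : i ∈ s) :
    Disjoint (blocksFullOn s) (mixedBlocks ι) :=
  (disjoint_blocksFullOn hs (notMem_empty i)).mono_right sdiff_subset

end BlocksFullOn

theorem card_blocksFullOn_Ici (t : Fin n) : #(blocksFullOn (Ici t)) = 2 ^ (t : ℕ) := by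
  rw [card_blocksFullOn, card_compl, Fintype.card_fin, Fin.card_Ici, Nat.sub_sub_self t.isLt.le]

theorem card_blocksFullOn_Iic (s : Fin n) : #(blocksFullOn (Iic s)) = 2 ^ (s.rev : ℕ) := by
  rw [card_blocksFullOn, card_compl, Fintype.card_fin, Fin.card_Iic, Fin.val_rev]

theorem sum_Iio_two_pow (b : Fin n) : ∑ t ∈ Iio b, 2 ^ (t : ℕ) = 2 ^ (b : ℕ) - 1 := by
  have hmap := sum_map (Iio b) Fin.valEmbedding fun k => 2 ^ k
  rw [Fin.map_valEmbedding_Iio, Nat.Iio_eq_range, Nat.geomSum_eq le_rfl, Nat.div_one] at hmap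
  exact hmap.symm

theorem card_biUnion_blocksFullOn_Ici (b : Fin n) :
    #((Iio b).biUnion fun t => blocksFullOn (Ici t)) = 2 ^ (b : ℕ) - 1 := by
  rw [card_biUnion, ← sum_Iio_two_pow]
  · exact sum_congr rfl fun t _ => card_blocksFullOn_Ici t
  · intro t _ t' _ hne
    rcases hne.lt_or_gt with h | h
    · exact disjoint_blocksFullOn (mem_Ici.2 le_rfl) (mem_Ici.not.2 h.not_ge)
    · exact (disjoint_blocksFullOn (mem_Ici.2 le_rfl) (mem_Ici.not.2 h.not_ge)).symm

theorem card_biUnion_blocksFullOn_Iic (b : Fin n) :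
    #((Ioi b).biUnion fun s => blocksFullOn (Iic s)) = 2 ^ (b.rev : ℕ) - 1 := by
  rw [card_biUnion, ← sum_Iio_two_pow]
  · rw [← b.rev_rev, ← Fin.map_revPerm_Iio, sum_map, Fin.rev_rev]
    refine sum_congr rfl fun t _ => ?_
    simp [card_blocksFullOn_Iic]
  · intro s _ s' _ hne
    rcases hne.lt_or_gt with h | h
    · exact (disjoint_blocksFullOn (mem_Iic.2 le_rfl) (mem_Iic.not.2 h.not_ge)).symm
    · exact disjoint_blocksFullOn (mem_Iic.2 le_rfl) (mem_Iic.not.2 h.not_ge)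

variable [NeZero n]

theorem mem_S1_iff {B : Signature n} :
    B ∈ S1 n ↔ (blocks B).1 ∈ (Iio (lastIdx n)).biUnion (fun t => blocksFullOn (Ici t)) ∧
      (blocks B).2 ∈ mixedBlocks (Fin n) := by
  simp only [mem_biUnion, mem_Iio, mem_blocksFullOn, mem_mixedBlocks, mem_Ici, not_le]
  constructor
  · rintro ⟨t, ht, hfull, hsplit, hmixed⟩
    exact ⟨⟨t, ht, hfull, hsplit⟩, hmixed⟩
  · rintro ⟨⟨t, ht, hfull, hsplit⟩, hmixed⟩
    exact ⟨t, ht, hfull, hsplit, hmixed⟩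

theorem mem_S2_iff {B : Signature n} :
    B ∈ S2 n ↔ (blocks B).1 ∈ blocksFullOn (Ici (lastIdx n)) ∧
      (blocks B).2 ∈ blocksFullOn (Iic (0 : Fin n)) := by
  have eq_last (i) (h : lastIdx n ≤ i) : i = lastIdx n := (le_lastIdx i).antisymm h
  have eq_zero (i : Fin n) (h : i ≤ 0) : i = 0 := h.antisymm (Fin.zero_le i)
  simp only [mem_blocksFullOn, mem_Ici, mem_Iic, not_le]
  constructor
  · rintro ⟨⟨h₀₀, h₀₁, h₁⟩, hsplit₀, hsplit₁⟩
    refine ⟨⟨fun i hi => ?_, hsplit₀⟩, fun i hi => ?_, hsplit₁⟩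
    · rw [eq_last i hi]
      exact ⟨h₀₀, h₀₁⟩
    · rw [eq_zero i hi]
      exact h₁
  · rintro ⟨⟨hfull₀, hsplit₀⟩, hfull₁, hsplit₁⟩
    exact ⟨⟨(hfull₀ _ le_rfl).1, (hfull₀ _ le_rfl).2, hfull₁ 0 le_rfl⟩, hsplit₀, hsplit₁⟩

theorem mem_S3_iff {B : Signature n} :
    B ∈ S3 n ↔ (blocks B).1 ∈ mixedBlocks (Fin n) ∧
      (blocks B).2 ∈ (Ioi (0 : Fin n)).biUnion fun s => blocksFullOn (Iic s) := by
  simp only [mem_biUnion, mem_Ioi, mem_blocksFullOn, mem_mixedBlocks, mem_Iic, not_le]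
  constructor
  · rintro ⟨s, hs, hfull, hsplit, hmixed⟩
    exact ⟨hmixed, s, hs, hfull, hsplit⟩
  · rintro ⟨hmixed, s, hs, hfull, hsplit⟩
    exact ⟨s, hs, hfull, hsplit, hmixed⟩

theorem ncard_S_eq_card_add :
    (S n).ncard =
      #((Iio (lastIdx n)).biUnion fun t => blocksFullOn (Ici t)) * #(mixedBlocks (Fin n)) +
      #(blocksFullOn (Ici (lastIdx n))) * #(blocksFullOn (Iic (0 : Fin n))) +
      #(mixedBlocks (Fin n)) * #((Ioi (0 : Fin n)).biUnion fun s => blocksFullOn (Iic s)) := by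
  have himage : blocks '' S n = ↑(
      ((Iio (lastIdx n)).biUnion fun t => blocksFullOn (Ici t)) ×ˢ mixedBlocks (Fin n) ∪
      blocksFullOn (Ici (lastIdx n)) ×ˢ blocksFullOn (Iic (0 : Fin n)) ∪
      mixedBlocks (Fin n) ×ˢ (Ioi (0 : Fin n)).biUnion fun s => blocksFullOn (Iic s)) := by
    refine (blocks.eq_preimage_iff_image_eq ..).1 (Set.ext fun B => ?_)
    simp only [S, Set.mem_union, mem_S1_iff, mem_S2_iff, mem_S3_iff, Set.mem_preimage, mem_coe,
      mem_union, mem_product]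
  rw [← Set.ncard_image_of_injective _ blocks.injective, himage, Set.ncard_coe_finset,
    card_union_of_disjoint, card_union_of_disjoint, card_product, card_product, card_product]
  · rw [disjoint_product]
    exact Or.inr (disjoint_blocksFullOn_mixedBlocks (mem_Iic.2 le_rfl)).symm
  · rw [disjoint_union_left, disjoint_product, disjoint_product, disjoint_biUnion_left]
    exact ⟨Or.inl fun t _ => disjoint_blocksFullOn_mixedBlocks (mem_Ici.2 le_rfl),
      Or.inl (disjoint_blocksFullOn_mixedBlocks (mem_Ici.2 le_rfl))⟩

variable (n) in
theorem ncard_S : ((S n).ncard : ℤ) = 5 * 4 ^ (n - 1) - 2 ^ (n + 2) + 4 := by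
  have hlast : (lastIdx n : ℕ) = n - 1 := rfl
  have hzero : ((0 : Fin n).rev : ℕ) = n - 1 := by simp [Fin.val_rev]
  rw [ncard_S_eq_card_add, card_biUnion_blocksFullOn_Ici, card_biUnion_blocksFullOn_Iic,
    card_blocksFullOn_Ici, card_blocksFullOn_Iic, card_mixedBlocks, hlast, hzero, Fintype.card_fin]
  obtain ⟨m, rfl⟩ := Nat.exists_eq_succ_of_ne_zero (NeZero.ne n)
  have one_le : 1 ≤ 2 ^ m := Nat.one_le_two_pow
  have two_le : 2 ≤ 2 ^ (m + 1) := Nat.le_self_pow (Nat.succ_ne_zero m) 2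
  have four_pow : (4 : ℤ) ^ m = 2 ^ m * 2 ^ m := by
    rw [← mul_pow]
    norm_num
  simp only [Nat.succ_eq_add_one, Nat.add_sub_cancel]
  push_cast [Nat.cast_sub one_le, Nat.cast_sub two_le]
  rw [four_pow]
  ring

end Counting

end BinaryIV

theorem mainTheorem1 (n : ℕ) [NeZero n] (γ : Fin n → ℝ) (hγ : StrictMono γ) :
    -- `V = u(S)` is a set of pairwise `M`-distinct vertices
    (∀ v ∈ BinaryIV.u γ '' BinaryIV.S n, BinaryIV.IsVertex γ v) ∧
    (BinaryIV.u γ '' BinaryIV.S n).Pairwise (fun v w => ¬ BinaryIV.MEquiv v w) ∧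
    -- every vertex is `M`-equivalent to a member of `V`
    (∀ v : BinaryIV.Col n 2 → ℝ, BinaryIV.IsVertex γ v →
      ∃ w ∈ BinaryIV.u γ '' BinaryIV.S n, BinaryIV.MEquiv v w) ∧
    -- `B ↦ [u(B)]` is a bijection from `S` onto the vertex classes
    (∃ h : ∀ B : BinaryIV.S n, BinaryIV.IsVertex γ (BinaryIV.u γ B.1),
      Function.Bijective (fun B : BinaryIV.S n =>
        (Quotient.mk (BinaryIV.vertexSetoid 2 γ) ⟨BinaryIV.u γ B.1, h B⟩ :
          BinaryIV.VertexClass 2 γ))) ∧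
    -- the number of vertex classes and of admissible signatures
    (Nat.card (BinaryIV.VertexClass 2 γ) : ℤ) = 5 * 4 ^ (n - 1) - 2 ^ (n + 2) + 4 ∧
    ((BinaryIV.S n).ncard : ℤ) = 5 * 4 ^ (n - 1) - 2 ^ (n + 2) + 4 := by
  have isVertex (B : BinaryIV.S n) : BinaryIV.IsVertex γ (BinaryIV.u γ B.1) :=
    BinaryIV.isVertex_u hγ B.2
  have bijective : Function.Bijective fun B : BinaryIV.S n =>
      (Quotient.mk (BinaryIV.vertexSetoid 2 γ) ⟨BinaryIV.u γ B.1, isVertex B⟩ :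
        BinaryIV.VertexClass 2 γ) := by
    refine ⟨fun B B' h => Subtype.ext (BinaryIV.eq_of_mEquiv_u hγ B.2 B'.2 (Quotient.exact h)), ?_⟩
    refine Quotient.ind fun v => ?_
    obtain ⟨B, hB, hv⟩ := BinaryIV.exists_mem_S_mEquiv_u hγ v.2
    exact ⟨⟨B, hB⟩, Quotient.sound hv.symm⟩
  have ncard_S := BinaryIV.ncard_S n
  refine ⟨?_, ?_, fun v hv => ?_, ⟨isVertex, bijective⟩, ?_, ncard_S⟩
  · rintro _ ⟨B, hB, rfl⟩
    exact isVertex ⟨B, hB⟩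
  · rintro _ ⟨B, hB, rfl⟩ _ ⟨B', hB', rfl⟩ hne h
    exact hne (congrArg _ (BinaryIV.eq_of_mEquiv_u hγ hB hB' h))
  · obtain ⟨B, hB, hvB⟩ := BinaryIV.exists_mem_S_mEquiv_u hγ hv
    exact ⟨_, ⟨B, hB, rfl⟩, hvB⟩
  · rw [← Nat.card_eq_of_bijective _ bijective, Nat.card_coe_set_eq, ncard_S]
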